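/- Consider the online TSP with time windows and unit service time in the uniform metric on $n\ge 2$ nodes. Time consists of unit slots $0,1,2,\dots$. A finite sequence $\sigma$ of requests $([r_i,d_i],v_i)$ with integers $r_i\ge 1$, $d_i$ and nodes $v_i$ is given; its minimum laxity is $\min_i (d_i-r_i)$. A server starts at some node. In each slot it is idle, moves to another node (all travel times are $1$), or serves one unserved request $i$ at its current node, where slot $t$ must satisfy $r_i\le t\le d_i$. The throughput is the number of served requests, and $\mathrm{OPT}(\sigma)$ is its maximum over all offline schedules. In each slot an online algorithm knows only the requests released so far; a randomized online algorithm is a probability distribution over deterministic ones. For an integer $L\ge 1$, an online algorithm $\mathrm{ALG}$ is $\rho$-competitive for laxity $L$ if $\mathrm{OPT}(\sigma)\le\rho\,\mathbb E[\mathrm{ALG}(\sigma)]$ for every input $\sigma$ whose minimum laxity is $L$. There is an absolute constant $c>0$ such that for all integers $n\ge 2$ and $L\ge 1$, every starting node, and every real $\rho$: if some deterministic or randomized online algorithm is $\rho$-competitive for laxity $L$ in the uniform metric on $n$ nodes, then $$\rho\ \ge\ 1+c\sqrt{n/L}\quad\text{if } L\ge 9n,\qquad\text{and}\qquad \rho\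 \ge\ 1.002\quad\text{if } L<9n .$$ -/

import Mathlib

open MeasureTheory

namespace UniformTSP

/-- A request `([release, deadline], node)` for one unit of service. Time is divided into unit slots
`0, 1, 2, …`; the request may be served in any slot `t` with `release ≤ t ≤ deadline`. -/
structure Request (n : ℕ) where
  release : ℕ
  deadline : ℕ
  node : Fin n
  deriving DecidableEq

/-- What the server does during one slot. All distances are `1`, so a move to any other node takes
exactly one slot. -/
inductive Action (n : ℕ) where
  | idle : Action n
  | move (v : Fin n) : Action n
  | serve (q : Request n) : Action n

/-- An input sequence: finitely many requests, possibly with several identical copies. -/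
abbrev Input (n : ℕ) := Multiset (Request n)

/-- `L` is the minimum laxity `min (d_i - r_i)` of the (nonempty) input `σ`, all of whose release
times are positive. -/
def HasMinLaxity {n : ℕ} (σ : Input n) (L : ℕ) : Prop :=
  (∀ q ∈ σ, 1 ≤ q.release) ∧
  (∀ q ∈ σ, q.release + L ≤ q.deadline) ∧
  ∃ q ∈ σ, q.release + L = q.deadline

/-- The node at which the server stands at the beginning of slot `t`, if it starts at `s` and
performs the actions `a 0, a 1, …`. -/
def position {n : ℕ} (s : Fin n) (a : ℕ → Action n) : ℕ → Fin n
  | 0 => s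
  | t + 1 =>
    match a t with
    | .move v => v
    | _ => position s a t

/-- The requests of `σ` that have been served before slot `t`. A `serve` action is effective if the
server stands at the node of the request, the slot lies in the time window, and a copy of the
request is still unserved; otherwise the slot is wasted. -/
def served {n : ℕ} (σ : Input n) (s : Fin n) (a : ℕ → Action n) : ℕ → Multiset (Request n)
  | 0 => 0
  | t + 1 =>
    match a t with
    | .serve q =>
      if q.node = position s a t ∧ q.release ≤ t ∧ t ≤ q.deadline ∧
          (served σ s a t).count q < σ.count q then
        q ::ₘ served σ s a t
      else served σ s a t
    | _ => served σ s a t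

/-- The first slot after all the deadlines of `σ`. -/
def horizon {n : ℕ} (σ : Input n) : ℕ := (σ.map Request.deadline).sup + 1

/-- The number of requests of `σ` that the action sequence `a` serves. -/
def throughput {n : ℕ} (σ : Input n) (s : Fin n) (a : ℕ → Action n) : ℕ :=
  (served σ s a (horizon σ)).card

theorem served_le {n : ℕ} (σ : Input n) (s : Fin n) (a : ℕ → Action n) (t : ℕ) :
    served σ s a t ≤ σ := by
  induction t with
  | zero => simp [served]
  | succ t ih =>
    unfold served
    split
    · split_ifs with h
      · rw [Multiset.le_iff_count] at ih ⊢
        intro x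
        rw [Multiset.count_cons]
        split_ifs with hx
        · subst hx; exact h.2.2.2
        · exact ih x
      · exact ih
    · exact ih

theorem throughput_le_card {n : ℕ} (σ : Input n) (s : Fin n) (a : ℕ → Action n) :
    throughput σ s a ≤ σ.card :=
  Multiset.card_le_card (served_le σ s a _)

/-- The optimal offline throughput; a supremum of natural numbers that are at most `σ.card`. -/
noncomputable def opt {n : ℕ} (σ : Input n) (s : Fin n) : ℕ :=
  ⨆ a : ℕ → Action n, throughput σ s a

theorem bddAbove_throughput {n : ℕ} (σ : Input n) (s : Fin n) :
    BddAbove (Set.range fun a : ℕ → Action n => throughput σ s a) :=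
  ⟨σ.card, by rintro _ ⟨a, rfl⟩; exact throughput_le_card σ s a⟩

/-- A deterministic online algorithm: in slot `t` it chooses its action from `t` and the requests
released up to slot `t` (its own earlier actions are determined by these). -/
abbrev OnlineAlgorithm (n : ℕ) := ℕ → Multiset (Request n) → Action n

/-- The actions that the algorithm `A` performs on the input `σ`. -/
def run {n : ℕ} (A : OnlineAlgorithm n) (σ : Input n) : ℕ → Action n :=
  fun t => A t (σ.filter fun q => q.release ≤ t)

/-- The throughput of the online algorithm `A` on `σ`. -/
def alg {n : ℕ} (A : OnlineAlgorithm n) (σ : Input n) (s : Fin n) : ℕ :=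
  throughput σ s (run A σ)

/-- `A` is `ρ`-competitive for inputs of minimum laxity `L`. -/
def IsCompetitive {n : ℕ} (A : OnlineAlgorithm n) (s : Fin n) (L : ℕ) (ρ : ℝ) : Prop :=
  ∀ σ : Input n, HasMinLaxity σ L → (opt σ s : ℝ) ≤ ρ * (alg A σ s : ℝ)

/-- Every set of actions (a countable type) is measurable; `OnlineAlgorithm n` carries the product
σ-algebra. -/
instance (n : ℕ) : MeasurableSpace (Action n) := ⊤

/-- A randomized online algorithm is a probability distribution `P` on deterministic online
algorithms; it is `ρ`-competitive for inputs of minimum laxity `L` if the optimum is at most `ρ`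
times its expected throughput, on every such input (fixed independently of the random choices). -/
def IsRandCompetitive {n : ℕ} (P : Measure (OnlineAlgorithm n)) (s : Fin n) (L : ℕ) (ρ : ℝ) :
    Prop :=
  ∀ σ : Input n, HasMinLaxity σ L → (opt σ s : ℝ) ≤ ρ * ∫ A, (alg A σ s : ℝ) ∂P

end UniformTSP

/-! ### Counting bounds along an action sequence -/

namespace UniformTSP

variable {n : ℕ}

/-! The adversary uses K phases of (3k+1)n slots, each opening with k demands at every node, all due
at a common deadline D. The server can fill its time with low-urgency fillers at `s`. At the end of
some phase τ a burst at `s` supplies enough requests due by D to fill all slots up to D, and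
replaces the fillers that the optimum has already served. The K possible inputs look alike until
their bursts.

Knowing τ, the optimum serves everything: it clears three batches per round trip, with the last trip
ending exactly at the burst, so it wastes only n(⌊τ/3⌋+1) slots on moves (`reach_phases`,
`card_le_opt_burstInput`). An online algorithm faces a dilemma. Every node left unvisited in phase τ
costs k requests, because its new demands compete with a burst that already fills the slots up to D
(`alg_add_le`). Visiting v nodes in a phase costs at least v-1 moves, so making a round trip in
every phase wastes about three times as many slots as the optimum does
(`alg_add_sum_visitedCount_le`).

Let S be the number of unvisited nodes, summed over the phases. Summed over all τ, the loss is at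
least kS and also at least a quantity of order nK² minus KS. With k = K this forces an average loss
of order nK (`totalLoss_self`). All services of an input fit into F = 1 + L + 2K(3k+1)n slots, so
the ratio is at least 1 plus average loss over F (`one_add_le_of_totalLoss`). Taking K of order
√(L/n) keeps F of order L and gives √(n/L); for small L, k = 1 and K = 3 suffice. Averaging over τ
is Yao's principle, so randomization does not help. -/

theorem position_congr {s : Fin n} {a b : ℕ → Action n} {t : ℕ} (h : ∀ i < t, a i = b i) :
    position s a t = position s b t := by
  induction t with
  | zero => rfl
  | succ t ih =>
    simp only [position, h t (Nat.lt_succ_self t),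
      ih fun i hi => h i (Nat.lt_succ_of_lt hi)]

theorem served_congr {σ : Input n} {s : Fin n} {a b : ℕ → Action n} {t : ℕ}
    (h : ∀ i < t, a i = b i) : served σ s a t = served σ s b t := by
  induction t with
  | zero => rfl
  | succ t ih =>
    have h' : ∀ i < t, a i = b i := fun i hi => h i (Nat.lt_succ_of_lt hi)
    simp only [served, h t (Nat.lt_succ_self t), ih h', position_congr h']

/-- What a slot can do to the multiset of served requests. -/
theorem served_succ_cases (σ : Input n) (s : Fin n) (a : ℕ → Action n) (t : ℕ) :
    served σ s a (t + 1) = served σ s a t ∨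
      ∃ q, a t = .serve q ∧ q.node = position s a t ∧ q.release ≤ t ∧ t ≤ q.deadline ∧
        q ∈ σ ∧ served σ s a (t + 1) = q ::ₘ served σ s a t := by
  cases h : a t with
  | idle => left; simp [served, h]
  | move v => left; simp [served, h]
  | serve q =>
    by_cases hq : q.node = position s a t ∧ q.release ≤ t ∧ t ≤ q.deadline ∧
          (served σ s a t).count q < σ.count q
    · right
      refine ⟨q, rfl, hq.1, hq.2.1, hq.2.2.1, ?_, by simp [served, h, hq]⟩
      exact Multiset.count_pos.1 (lt_of_le_of_lt (Nat.zero_le _) hq.2.2.2)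
    · left; simp only [served, h, if_neg hq]

theorem served_mono (σ : Input n) (s : Fin n) (a : ℕ → Action n) {t u : ℕ} (h : t ≤ u) :
    served σ s a t ≤ served σ s a u := by
  induction u, h using Nat.le_induction with
  | base => exact le_rfl
  | succ u _ ih =>
    rcases served_succ_cases σ s a u with h | ⟨q, -, -, -, -, -, h⟩
    · rw [h]; exact ih
    · rw [h]; exact ih.trans (Multiset.le_cons_self _ _)

/-- A served request was served in some slot of its window, with the server at its node. -/
theorem exists_slot_of_mem_served {σ : Input n} {s : Fin n} {a : ℕ → Action n} {t : ℕ}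
    {q : Request n} (h : q ∈ served σ s a t) :
    ∃ i < t, q.release ≤ i ∧ i ≤ q.deadline ∧ position s a i = q.node := by
  induction t with
  | zero => simp [served] at h
  | succ t ih =>
    rcases served_succ_cases σ s a t with h' | ⟨r, -, h1, h2, h3, -, h'⟩
    · rw [h'] at h
      obtain ⟨i, hi, h⟩ := ih h
      exact ⟨i, by omega, h⟩
    · rw [h', Multiset.mem_cons] at h
      rcases h with rfl | h
      · exact ⟨t, by omega, h2, h3, h1.symm⟩
      · obtain ⟨i, hi, h⟩ := ih h
        exact ⟨i, by omega, h⟩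

/-- The number of slots in `[t, u)` in which the server moves. -/
def moves (a : ℕ → Action n) (t u : ℕ) : ℕ :=
  ∑ i ∈ Finset.Ico t u, match a i with
    | .move _ => 1
    | _ => 0

/-- A slot is used for at most one service or one move, never both. Slot 0 serves nothing because
all releases are positive, so only slots 1 to t count. -/
theorem card_served_add_moves_le {σ : Input n} (hσ : ∀ q ∈ σ, 1 ≤ q.release) (s : Fin n)
    (a : ℕ → Action n) (t : ℕ) : (served σ s a (t + 1)).card + moves a 1 (t + 1) ≤ t := by
  induction t with
  | zero =>
    rcases served_succ_cases σ s a 0 with h | ⟨q, -, -, h2, -, h4, -⟩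
    · rw [h]; simp [served, moves]
    · have := hσ q h4; omega
  | succ t ih =>
    have hm : moves a 1 (t + 1 + 1) = moves a 1 (t + 1) +
        match a (t + 1) with
        | .move _ => 1
        | _ => 0 := by
      unfold moves
      rw [Finset.sum_Ico_succ_top (by omega)]
    rcases served_succ_cases σ s a (t + 1) with h | ⟨q, h1, -, -, -, -, h⟩
    · rw [h, hm]
      split <;> omega
    · rw [h, hm, h1, Multiset.card_cons]
      simp only
      omega

theorem moves_eq_sum_of_monotone (a : ℕ → Action n) {f : ℕ → ℕ} (hf : Monotone f) (m : ℕ) :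
    moves a (f 0) (f m) = ∑ j ∈ Finset.range m, moves a (f j) (f (j + 1)) := by
  induction m with
  | zero => simp [moves]
  | succ m ih =>
    rw [Finset.sum_range_succ, ← ih]
    unfold moves
    rw [Finset.sum_Ico_consecutive _ (hf (Nat.zero_le _)) (hf (Nat.le_succ _))]

theorem moves_mono_right (a : ℕ → Action n) (t : ℕ) {u v : ℕ} (h : u ≤ v) :
    moves a t u ≤ moves a t v :=
  Finset.sum_le_sum_of_subset (Finset.Ico_subset_Ico_right h)

theorem moves_congr {a b : ℕ → Action n} {t u : ℕ} (h : ∀ i < u, a i = b i) :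
    moves a t u = moves b t u :=
  Finset.sum_congr rfl fun i hi => by rw [h i (Finset.mem_Ico.1 hi).2]

/-- The nodes at which the server stands in the slots of `[t, u)`. -/
def visited (s : Fin n) (a : ℕ → Action n) (t u : ℕ) : Finset (Fin n) :=
  (Finset.Ico t u).image (position s a)

theorem visited_congr {s : Fin n} {a b : ℕ → Action n} {t u : ℕ} (h : ∀ i < u, a i = b i) :
    visited s a t u = visited s b t u :=
  Finset.image_congr fun _ hi => position_congr fun j hj =>
    h j (hj.trans (Finset.mem_Ico.1 (Finset.mem_coe.1 hi)).2)

/-- Each node beyond the first has to be entered by a move. -/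
theorem card_visited_le (s : Fin n) (a : ℕ → Action n) (t u : ℕ) :
    (visited s a t u).card ≤ 1 + moves a t u := by
  -- A move in the last slot changes the position only afterwards, so the induction also counts the
  -- position at the right end.
  suffices h : ∀ m, (insert (position s a (t + m)) (visited s a t (t + m))).card ≤
      1 + moves a t (t + m) by
    rcases le_total t u with htu | htu
    · obtain ⟨m, rfl⟩ := Nat.exists_eq_add_of_le htu
      exact (Finset.card_le_card (Finset.subset_insert _ _)).trans (h m)
    · simp [visited, Finset.Ico_eq_empty_of_le htu]
  intro m
  induction m with
  | zero => simp [visited, moves]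
  | succ m ih =>
    have hv : visited s a t (t + (m + 1)) =
        insert (position s a (t + m)) (visited s a t (t + m)) := by
      unfold visited
      rw [← add_assoc, ← Finset.insert_Ico_right_eq_Ico_add_one (by omega), Finset.image_insert]
    have hm : moves a t (t + (m + 1)) = moves a t (t + m) +
        match a (t + m) with
        | .move _ => 1
        | _ => 0 := by
      unfold moves
      rw [← add_assoc, Finset.sum_Ico_succ_top (by omega)]
    rw [hv, hm, ← add_assoc]
    cases h : a (t + m) with
    | idle => simpa [position, h] using ih
    | serve q => simpa [position, h] using ih
    | move v =>
      refine (Finset.card_insert_le _ _).trans ?_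
      simp only
      omega

/-- From slot `t` on, at most `D + 1 - t` requests with deadline at most `D` are served. -/
theorem countP_served_le (σ : Input n) (s : Fin n) (a : ℕ → Action n) (D t u : ℕ) (htu : t ≤ u) :
    (served σ s a u).countP (fun q => q.deadline ≤ D) ≤
      (served σ s a t).countP (fun q => q.deadline ≤ D) + (min u (D + 1) - t) := by
  induction u, htu using Nat.le_induction with
  | base => omega
  | succ u hu ih =>
    rcases served_succ_cases σ s a u with h | ⟨q, -, -, -, h3, -, h⟩
    · rw [h]; omega
    · rw [h, Multiset.countP_cons]
      split_ifs with hq <;> omega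

/-! ### Building offline schedules -/

/-- The server can be at node `p` before slot `t`, having served exactly the requests in `S`. -/
def Reach (σ : Input n) (s : Fin n) (t : ℕ) (p : Fin n) (S : Multiset (Request n)) : Prop :=
  ∃ a : ℕ → Action n, position s a t = p ∧ served σ s a t = S

/-- The action in slot t affects neither the position nor the services before t, so it can be
overwritten freely. -/
theorem Reach.step {σ : Input n} {s : Fin n} {t : ℕ} {p : Fin n} {S : Multiset (Request n)}
    (h : Reach σ s t p S) (x : Action n) :
    ∃ a : ℕ → Action n, position s a t = p ∧ served σ s a t = S ∧ a t = x := by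
  obtain ⟨a, h1, h2⟩ := h
  have ha : ∀ i < t, Function.update a t x i = a i := fun i hi =>
    Function.update_of_ne hi.ne _ _
  exact ⟨Function.update a t x, (position_congr ha).trans h1, (served_congr ha).trans h2, by simp⟩

theorem Reach.idle {σ : Input n} {s : Fin n} {t : ℕ} {p : Fin n} {S : Multiset (Request n)}
    (h : Reach σ s t p S) : Reach σ s (t + 1) p S := by
  obtain ⟨a, h1, h2, h3⟩ := h.step .idle
  exact ⟨a, by simp [position, h3, h1], by simp [served, h3, h2]⟩

theorem Reach.move {σ : Input n} {s : Fin n} {t : ℕ} {p : Fin n} {S : Multiset (Request n)}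
    (h : Reach σ s t p S) (v : Fin n) : Reach σ s (t + 1) v S := by
  obtain ⟨a, h1, h2, h3⟩ := h.step (.move v)
  exact ⟨a, by simp [position, h3], by simp [served, h3, h2]⟩

theorem Reach.serve {σ : Input n} {s : Fin n} {t : ℕ} {p : Fin n} {S : Multiset (Request n)}
    (h : Reach σ s t p S) (R : Multiset (Request n)) (hR : ∀ q ∈ R, q.node = p ∧ q.release ≤ t ∧
      t + R.card ≤ q.deadline + 1) (hσ : S + R ≤ σ) : Reach σ s (t + R.card) p (S + R) := by
  induction R using Multiset.induction_on with
  | empty => simpa using h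
  | cons q R ih =>
    have hle : S + R ≤ σ := le_trans (by simp [Multiset.le_cons_self]) hσ
    have h' := ih (fun r hr => by
      have := hR r (Multiset.mem_cons_of_mem hr)
      rw [Multiset.card_cons] at this
      exact ⟨this.1, this.2.1, by omega⟩) hle
    obtain ⟨h1, h2, h3⟩ := hR q (Multiset.mem_cons_self _ _)
    rw [Multiset.card_cons] at h3 ⊢
    obtain ⟨a, ha1, ha2, ha3⟩ := h'.step (.serve q)
    have hc : (served σ s a (t + R.card)).count q < σ.count q := by
      rw [ha2]
      have := Multiset.count_le_of_le q hσ
      rw [Multiset.add_cons, Multiset.count_cons_self] at this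
      omega
    refine ⟨a, by simp [position, ha3, ha1], ?_⟩
    rw [← add_assoc]
    simp only [served, ha3]
    rw [if_pos ⟨by rw [ha1, h1], by omega, by omega, hc⟩, ha2, Multiset.add_cons]

/-- In the uniform metric the order of the nodes is immaterial: each costs one slot for the move and
c for its services. -/
theorem Reach.tour {σ : Input n} {s : Fin n} {t : ℕ} {p : Fin n} {S : Multiset (Request n)}
    (h : Reach σ s t p S) (R : Fin n → Multiset (Request n)) (c : ℕ) (hc : ∀ v, (R v).card = c)
    (U : Finset (Fin n))
    (hR : ∀ v, ∀ q ∈ R v, q.node = v ∧ q.release ≤ t ∧ t + U.card * (c + 1) ≤ q.deadline + 1)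
    (hσ : S + ∑ v ∈ U, R v ≤ σ) :
    ∃ p', Reach σ s (t + U.card * (c + 1)) p' (S + ∑ v ∈ U, R v) := by
  induction U using Finset.induction_on with
  | empty => exact ⟨p, by simpa using h⟩
  | insert v U hv ih =>
    rw [Finset.card_insert_of_notMem hv] at hR ⊢
    rw [Finset.sum_insert hv, add_comm (R v), ← add_assoc] at hσ ⊢
    have hm : (U.card + 1) * (c + 1) = U.card * (c + 1) + 1 + c := by ring
    obtain ⟨p', h'⟩ := ih (fun w q hq => ⟨(hR w q hq).1, (hR w q hq).2.1, by
      have := (hR w q hq).2.2; omega⟩) ((Multiset.le_add_right _ _).trans hσ)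
    have := (h'.move v).serve (R v) (fun q hq => by
      obtain ⟨h1, h2, h3⟩ := hR v q hq
      rw [hc]
      exact ⟨h1, by omega, by omega⟩) hσ
    rw [hc] at this
    exact ⟨v, by rw [hm, ← add_assoc, ← add_assoc]; exact this⟩

/-- A round trip through all nodes. -/
theorem Reach.roundTrip {σ : Input n} {s : Fin n} {t : ℕ} {S : Multiset (Request n)}
    (h : Reach σ s t s S) (R : Fin n → Multiset (Request n)) (c : ℕ) (hc : ∀ v, (R v).card = c)
    (hR : ∀ v, ∀ q ∈ R v, q.node = v ∧ q.release ≤ t ∧ t + n * (c + 1) ≤ q.deadline + 1)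
    (hσ : S + ∑ v, R v ≤ σ) : Reach σ s (t + n * (c + 1)) s (S + ∑ v, R v) := by
  classical
  have hcard : (Finset.univ.erase s).card + 1 = n := by
    rw [Finset.card_erase_add_one (Finset.mem_univ s), Finset.card_univ, Fintype.card_fin]
  have hm : ((Finset.univ.erase s).card + 1) * (c + 1) =
    (Finset.univ.erase s).card * (c + 1) + 1 + c := by ring
  rw [hcard] at hm
  -- The node `s` comes last, so that the trip ends where it began.
  rw [← Finset.sum_erase_add _ _ (Finset.mem_univ s), ← add_assoc] at hσ ⊢
  obtain ⟨p, hp⟩ := h.tour R c hc (Finset.univ.erase s) (fun v q hq => by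
    obtain ⟨h1, h2, h3⟩ := hR v q hq
    exact ⟨h1, h2, by omega⟩) ((Multiset.le_add_right _ _).trans hσ)
  have := (hp.move s).serve (R s) (fun q hq => by
    obtain ⟨h1, h2, h3⟩ := hR s q hq
    rw [hc]
    exact ⟨h1, by omega, by omega⟩) hσ
  rw [hc] at this
  rw [hm, ← add_assoc, ← add_assoc]
  exact this

theorem Reach.card_le_opt {σ : Input n} {s : Fin n} {t : ℕ} {p : Fin n}
    {S : Multiset (Request n)} (h : Reach σ s t p S) (ht : t ≤ horizon σ) :
    S.card ≤ opt σ s := by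
  obtain ⟨a, -, rfl⟩ := h
  exact (Multiset.card_le_card (served_mono σ s a ht)).trans
    (le_ciSup (bddAbove_throughput σ s) a)

/-! ### Measurability of the throughput -/

instance : Countable (Request n) :=
  Function.Injective.countable (f := fun q : Request n => (q.release, q.deadline, q.node))
    fun ⟨_, _, _⟩ ⟨_, _, _⟩ h => by simpa using h

instance : Countable (Action n) :=
  Function.Injective.countable
    (f := fun x : Action n => match x with
      | .idle => (none : Option (Fin n ⊕ Request n))
      | .move v => some (.inl v)
      | .serve q => some (.inr q))
    fun x y h => by cases x <;> cases y <;> simp_all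

instance : DiscreteMeasurableSpace (Action n) := ⟨fun _ => trivial⟩

/-- The throughput on a fixed input depends on finitely many decisions of the algorithm. -/
theorem measurable_alg (σ : Input n) (s : Fin n) :
    Measurable fun A : OnlineAlgorithm n => alg A σ s := by
  let T := horizon σ
  let g : (Fin T → Action n) → ℕ := fun b =>
    throughput σ s fun t => if h : t < T then b ⟨t, h⟩ else .idle
  have hg : Measurable g := .of_discrete
  have hr : Measurable fun A : OnlineAlgorithm n => fun i : Fin T => run A σ i := by
    refine measurable_pi_lambda _ fun i => ?_
    exact (measurable_pi_apply _).comp (measurable_pi_apply (i : ℕ))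
  convert hg.comp hr using 2 with A
  simp only [Function.comp, g, alg, throughput]
  congr 1
  exact served_congr fun i hi => by rw [dif_pos hi]

theorem integrable_alg (P : Measure (OnlineAlgorithm n)) [IsProbabilityMeasure P] (σ : Input n)
    (s : Fin n) : Integrable (fun A => (alg A σ s : ℝ)) P := by
  refine Integrable.of_bound (C := (σ.card : ℝ))
    ((measurable_from_top (f := fun m : ℕ => (m : ℝ))).comp
      (measurable_alg σ s)).aestronglyMeasurable (.of_forall fun A => ?_)
  rw [Real.norm_of_nonneg (Nat.cast_nonneg _)]
  exact_mod_cast throughput_le_card σ s _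

end UniformTSP

/-! ### The hard inputs -/

namespace UniformTSP

variable {n : ℕ}

/-- The length of a phase; `k` requests per node are released at its beginning. -/
def phaseLength (n k : ℕ) : ℕ := (3 * k + 1) * n

/-- The first slot of phase `j`. -/
def phaseStart (n k j : ℕ) : ℕ := 1 + j * phaseLength n k

/-- The deadline of the demands, for `K` phases. -/
def demandDeadline (n k K L : ℕ) : ℕ := phaseStart n k K + L

/-- The deadline of the fillers. -/
def fillerDeadline (n k K L : ℕ) : ℕ := demandDeadline n k K L + K * phaseLength n k

/-- A request of low urgency at the starting node. -/
def filler (n k K L : ℕ) (s : Fin n) : Request n := ⟨1, fillerDeadline n k K L, s⟩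

/-- The number of fillers that the optimum serves up to the end of phase `τ`. -/
def fillerCount (n k τ : ℕ) : ℕ := n * ((τ + 1) * (2 * k + 1) - (τ / 3 + 1))

/-- The request released at node `v` at the beginning of phase `j`. -/
def demand (k K L j : ℕ) (v : Fin n) : Request n :=
  ⟨phaseStart n k j, demandDeadline n k K L, v⟩

/-- All the requests released at the beginning of phase `j ≥ 1`. -/
def demandBatch (n k K L j : ℕ) : Input n := ∑ v : Fin n, Multiset.replicate k (demand k K L j v)

/-- The requests of the first `m` phases, without a burst. -/
def calmInput (n k K L : ℕ) (s : Fin n) (m : ℕ) : Input n :=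
  Multiset.replicate (K * phaseLength n k) (filler n k K L s) +
    ∑ j ∈ Finset.range m, demandBatch n k K L j

/-- The requests at the starting node released at the end of phase `τ`: they fill all the slots
up to the deadline of the demands, and replace the fillers served before. -/
def burst (n k K L : ℕ) (s : Fin n) (τ : ℕ) : Input n :=
  ⟨phaseStart n k (τ + 1), phaseStart n k (τ + 1) + L, s⟩ ::ₘ
    (Multiset.replicate (demandDeadline n k K L - phaseStart n k (τ + 1))
        ⟨phaseStart n k (τ + 1), demandDeadline n k K L, s⟩ +
      Multiset.replicate (fillerCount n k τ)
        ⟨phaseStart n k (τ + 1), fillerDeadline n k K L, s⟩)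

/-- The input whose burst comes at the end of phase `τ`. -/
def burstInput (n k K L : ℕ) (s : Fin n) (τ : ℕ) : Input n :=
  calmInput n k K L s (τ + 1) + burst n k K L s τ

variable {k K L τ : ℕ} {s : Fin n}

theorem phaseStart_mono (n k : ℕ) : Monotone (phaseStart n k) := fun i j h => by
  unfold phaseStart
  have := Nat.mul_le_mul_right (phaseLength n k) h
  omega

theorem phaseStart_succ (n k j : ℕ) :
    phaseStart n k (j + 1) = phaseStart n k j + phaseLength n k := by
  unfold phaseStart; ring

theorem one_le_phaseStart (n k j : ℕ) : 1 ≤ phaseStart n k j := by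
  unfold phaseStart; omega

theorem phaseLength_pos (hn : 0 < n) : 0 < phaseLength n k := by
  unfold phaseLength; positivity

theorem phaseStart_add_le (hτ : τ < K) :
    phaseStart n k (τ + 1) + L ≤ demandDeadline n k K L := by
  have := phaseStart_mono n k (Nat.succ_le_of_lt hτ)
  simpa [demandDeadline] using this

theorem demandDeadline_lt (hn : 0 < n) (hτ : τ < K) :
    demandDeadline n k K L < fillerDeadline n k K L := by
  have := Nat.mul_pos (Nat.zero_lt_of_lt hτ) (phaseLength_pos (k := k) hn)
  unfold fillerDeadline; omega

/-- The truncated subtraction in `fillerCount` is a genuine one. -/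
theorem add_fillerCount (n k τ : ℕ) :
    fillerCount n k τ + n * (τ / 3 + 1) = n * ((τ + 1) * (2 * k + 1)) := by
  unfold fillerCount
  rw [← Nat.mul_add, Nat.sub_add_cancel]
  calc τ / 3 + 1 ≤ (τ + 1) * 1 := by omega
    _ ≤ _ := Nat.mul_le_mul_left _ (by omega)

/-- How the slots of the first `τ + 1` phases are used by the optimum. -/
theorem phaseStart_succ_eq (n k τ : ℕ) :
    phaseStart n k (τ + 1) =
      1 + (τ + 1) * (n * k) + fillerCount n k τ + n * (τ / 3 + 1) := by
  rw [add_assoc, add_fillerCount]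
  unfold phaseStart phaseLength
  ring

theorem card_demandBatch (n k K L j : ℕ) : (demandBatch n k K L j).card = n * k := by
  simp [demandBatch, Multiset.card_sum]

theorem card_calmInput (n k K L : ℕ) (s : Fin n) (m : ℕ) :
    (calmInput n k K L s m).card = K * phaseLength n k + m * (n * k) := by
  simp [calmInput, Multiset.card_sum, card_demandBatch]

/-- The slots from 1 to the last deadline are exactly enough for all requests and the moves of
⌊τ/3⌋+1 round trips. -/
theorem card_burstInput (hτ : τ < K) :
    (burstInput n k K L s τ).card + n * (τ / 3 + 1) = fillerDeadline n k K L := by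
  have h1 := phaseStart_succ_eq n k τ
  have h2 := phaseStart_add_le (n := n) (k := k) (L := L) hτ
  simp only [burstInput, card_calmInput, burst, Multiset.card_add, Multiset.card_cons,
    Multiset.card_replicate]
  unfold fillerDeadline
  omega

theorem mem_demandBatch {j : ℕ} {q : Request n} (h : q ∈ demandBatch n k K L j) :
    ∃ v, q = demand k K L j v := by
  obtain ⟨v, -, hv⟩ := Multiset.mem_sum.1 h
  exact ⟨v, Multiset.eq_of_mem_replicate hv⟩

theorem mem_burst {q : Request n} (h : q ∈ burst n k K L s τ) :
    q.release = phaseStart n k (τ + 1) ∧ q.node = s ∧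
      (q.deadline = phaseStart n k (τ + 1) + L ∨ q.deadline = demandDeadline n k K L ∨
        q.deadline = fillerDeadline n k K L) := by
  rw [burst, Multiset.mem_cons, Multiset.mem_add] at h
  rcases h with rfl | h | h
  · simp
  · rw [Multiset.eq_of_mem_replicate h]; simp
  · rw [Multiset.eq_of_mem_replicate h]; simp

theorem mem_burstInput {q : Request n} (h : q ∈ burstInput n k K L s τ) :
    q = filler n k K L s ∨ (∃ j ≤ τ, ∃ v, q = demand k K L j v) ∨ q ∈ burst n k K L s τ := by
  rw [burstInput, calmInput, Multiset.mem_add, Multiset.mem_add] at h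
  rcases h with (h | h) | h
  · exact .inl (Multiset.eq_of_mem_replicate h)
  · obtain ⟨j, hj, h⟩ := Multiset.mem_sum.1 h
    exact .inr (.inl ⟨j, by simpa [Nat.lt_succ_iff] using hj, mem_demandBatch h⟩)
  · exact .inr (.inr h)

theorem hasMinLaxity_burstInput (hτ : τ < K) : HasMinLaxity (burstInput n k K L s τ) L := by
  have h1 := one_le_phaseStart n k
  have h2 := phaseStart_add_le (n := n) (k := k) (L := L) hτ
  have h3 : demandDeadline n k K L ≤ fillerDeadline n k K L := Nat.le_add_right _ _
  have h4 : ∀ j ≤ τ, phaseStart n k j ≤ phaseStart n k (τ + 1) := fun j hj =>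
    phaseStart_mono n k (by omega)
  refine ⟨fun q hq => ?_, fun q hq => ?_, ?_⟩
  · rcases mem_burstInput hq with rfl | ⟨j, -, v, rfl⟩ | h
    · exact le_rfl
    · exact h1 j
    · rw [(mem_burst h).1]; exact h1 _
  · rcases mem_burstInput hq with rfl | ⟨j, hj, v, rfl⟩ | h
    · have := h1 (τ + 1)
      simp only [filler]; omega
    · have := h4 j hj
      simp only [demand]; omega
    · obtain ⟨h5, -, h6⟩ := mem_burst h
      omega
  · exact ⟨_, Multiset.mem_add.2 (.inr (Multiset.mem_cons_self _ _)), rfl⟩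

theorem horizon_burstInput (hn : 0 < n) (hτ : τ < K) :
    horizon (burstInput n k K L s τ) = fillerDeadline n k K L + 1 := by
  have h2 := phaseStart_add_le (n := n) (k := k) (L := L) hτ
  have h3 := demandDeadline_lt (k := k) (L := L) hn hτ
  unfold horizon
  congr 1
  refine le_antisymm (Multiset.sup_le.2 fun d hd => ?_) (Multiset.le_sup ?_)
  · obtain ⟨q, hq, rfl⟩ := Multiset.mem_map.1 hd
    rcases mem_burstInput hq with rfl | ⟨j, -, v, rfl⟩ | h
    · exact le_rfl
    · exact h3.le
    · obtain ⟨-, -, h6⟩ := mem_burst h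
      omega
  · refine Multiset.mem_map.2 ⟨filler n k K L s, ?_, rfl⟩
    refine Multiset.mem_add.2 (.inl (Multiset.mem_add.2 (.inl (Multiset.mem_replicate.2 ⟨?_, rfl⟩))))
    exact (Nat.mul_pos (Nat.zero_lt_of_lt hτ) (phaseLength_pos hn)).ne'

/-- Before the burst an online algorithm cannot know when it comes. -/
theorem run_burstInput (A : OnlineAlgorithm n) (hτ : τ < K) {t : ℕ}
    (ht : t < phaseStart n k (τ + 1)) :
    run A (burstInput n k K L s τ) t = run A (calmInput n k K L s K) t := by
  unfold run
  congr 1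
  have hb : (burst n k K L s τ).filter (fun q => q.release ≤ t) = 0 :=
    Multiset.filter_eq_nil.2 fun q hq => by rw [(mem_burst hq).1]; omega
  have hd : (∑ j ∈ Finset.Ico (τ + 1) K, demandBatch n k K L j).filter
      (fun q => q.release ≤ t) = 0 :=
    Multiset.filter_eq_nil.2 fun q hq => by
      obtain ⟨j, hj, h⟩ := Multiset.mem_sum.1 hq
      obtain ⟨v, rfl⟩ := mem_demandBatch h
      have := phaseStart_mono n k (Finset.mem_Ico.1 hj).1
      simp only [demand]; omega
  unfold burstInput calmInput
  rw [← Finset.sum_range_add_sum_Ico _ (Nat.succ_le_of_lt hτ), ← add_assoc,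
    Multiset.filter_add, hb, Multiset.filter_add _ _ (∑ j ∈ Finset.Ico (τ + 1) K, _), hd]

/-! ### The two losses of an online algorithm -/

section Online

variable (A : OnlineAlgorithm n)

/-- The number of nodes that `A` visits in phase `j` if there is no burst before. -/
def visitedCount (k K L : ℕ) (s : Fin n) (A : OnlineAlgorithm n) (j : ℕ) : ℕ :=
  (visited s (run A (calmInput n k K L s K)) (phaseStart n k j) (phaseStart n k (j + 1))).card

theorem visitedCount_le (j : ℕ) : visitedCount k K L s A j ≤ n := by
  simpa [visitedCount] using Finset.card_le_univ
    (visited s (run A (calmInput n k K L s K)) (phaseStart n k j) (phaseStart n k (j + 1)))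

/-- The slots spent on moves are lost. -/
theorem alg_add_sum_visitedCount_le (hn : 0 < n) (hτ : τ < K) :
    alg A (burstInput n k K L s τ) s + ∑ j ∈ Finset.range (τ + 1), visitedCount k K L s A j ≤
      fillerDeadline n k K L + (τ + 1) := by
  have h1 := card_served_add_moves_le (hasMinLaxity_burstInput (n := n) (k := k) (L := L) (s := s)
    hτ).1 s (run A (burstInput n k K L s τ)) (fillerDeadline n k K L)
  have h2 : phaseStart n k (τ + 1) ≤ fillerDeadline n k K L + 1 := by
    have := phaseStart_add_le (n := n) (k := k) (L := L) hτ
    have := demandDeadline_lt (k := k) (L := L) hn hτ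
    omega
  have h3 := moves_mono_right (run A (burstInput n k K L s τ)) 1 h2
  rw [moves_congr (b := run A (calmInput n k K L s K)) fun i hi => run_burstInput A hτ hi] at h3
  have h4 := moves_eq_sum_of_monotone (run A (calmInput n k K L s K)) (phaseStart_mono n k) (τ + 1)
  have h5 : phaseStart n k 0 = 1 := by simp [phaseStart]
  rw [h5] at h4
  have h6 : ∑ j ∈ Finset.range (τ + 1), visitedCount k K L s A j ≤
      ∑ j ∈ Finset.range (τ + 1), (1 + moves (run A (calmInput n k K L s K))
        (phaseStart n k j) (phaseStart n k (j + 1))) :=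
    Finset.sum_le_sum fun j _ => card_visited_le _ _ _ _
  rw [Finset.sum_add_distrib, ← h4] at h6
  simp only [Finset.sum_const, Finset.card_range, smul_eq_mul, mul_one] at h6
  unfold alg throughput
  rw [horizon_burstInput hn hτ]
  omega

/-- The demands released in phase `τ` at a node not visited in this phase are lost. -/
theorem alg_add_le (hn : 0 < n) (hτ : τ < K) :
    alg A (burstInput n k K L s τ) s + k * n ≤
      (burstInput n k K L s τ).card + k * visitedCount k K L s A τ := by
  set σ := burstInput n k K L s τ with hσ
  set a := run A σ
  set e := phaseStart n k (τ + 1) with he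
  set D := demandDeadline n k K L with hD
  have h2 : e + L ≤ D := phaseStart_add_le hτ
  have h3 : D < fillerDeadline n k K L := demandDeadline_lt hn hτ
  let V := visited s a (phaseStart n k τ) e
  have hV : V.card = visitedCount k K L s A τ :=
    congrArg Finset.card (visited_congr fun i hi => run_burstInput A hτ hi)
  let p : Request n → Prop := fun q => q.deadline ≤ D
  -- The requests due by D that can have been served before the burst: among the demands of phase τ,
  -- only those at nodes visited in that phase.
  let Q : Request n → Prop := fun q =>
    q.deadline ≤ D ∧ q.release < e ∧ (q.release = phaseStart n k τ → q.node ∈ V)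
  have hsum : ∀ (P : Request n → Prop) [DecidablePred P] (ι : Type) (S : Finset ι)
      (f : ι → Multiset (Request n)),
      (∑ i ∈ S, f i).countP P = ∑ i ∈ S, (f i).countP P := fun P _ ι S f =>
    map_sum (Multiset.countPAddMonoidHom P) f S
  have hserved : (served σ s a e).countP p ≤ τ * (n * k) + V.card * k := by
    have h4 : (served σ s a e).countP p = (served σ s a e).countP Q := by
      refine Multiset.countP_congr rfl fun q hq => ?_
      obtain ⟨i, hi, h5, h6, h7⟩ := exists_slot_of_mem_served hq
      refine eq_iff_iff.2 ⟨fun h => ⟨h, by omega, fun h8 => ?_⟩, fun h => h.1⟩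
      exact Finset.mem_image.2 ⟨i, Finset.mem_Ico.2 ⟨by omega, hi⟩, h7⟩
    rw [h4]
    refine (Multiset.countP_le_of_le Q (served_le σ s a e)).trans ?_
    rw [hσ, burstInput, calmInput, Multiset.countP_add, Multiset.countP_add, hsum,
      Finset.sum_range_succ]
    have h5 : (Multiset.replicate (K * phaseLength n k) (filler n k K L s)).countP Q = 0 :=
      Multiset.countP_eq_zero.2 fun q hq h => by
        rw [Multiset.eq_of_mem_replicate hq] at h
        exact absurd h.1 (by simp only [filler]; omega)
    have h6 : (burst n k K L s τ).countP Q = 0 :=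
      Multiset.countP_eq_zero.2 fun q hq h => by
        have := (mem_burst hq).1
        have := h.2.1
        omega
    have h7 : ∑ j ∈ Finset.range τ, (demandBatch n k K L j).countP Q ≤ τ * (n * k) := by
      refine (Finset.sum_le_card_nsmul _ _ (n * k) fun j _ => ?_).trans (by simp)
      exact (Multiset.countP_le_card _ _).trans (card_demandBatch n k K L j).le
    have h8 : (demandBatch n k K L τ).countP Q ≤ V.card * k := by
      rw [demandBatch, hsum, ← Finset.sum_subset (Finset.subset_univ V)]
      · refine (Finset.sum_le_card_nsmul _ _ k fun v _ => ?_).trans (by simp)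
        exact (Multiset.countP_le_card _ _).trans (by simp)
      · intro v _ hv
        refine Multiset.countP_eq_zero.2 fun q hq h => hv ?_
        rw [Multiset.eq_of_mem_replicate hq] at h
        exact h.2.2 rfl
    omega
  -- Requests due after D are bounded by their number, those due by D and served from the burst on
  -- by the D + 1 - e remaining slots.
  have h9 : (served σ s a (horizon σ)).countP (fun q => ¬ p q) ≤
      K * phaseLength n k + fillerCount n k τ := by
    refine (Multiset.countP_le_of_le _ (served_le σ s a _)).trans ?_
    have h4 : σ = ((∑ j ∈ Finset.range (τ + 1), demandBatch n k K L j) +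
        (⟨e, e + L, s⟩ ::ₘ Multiset.replicate (D - e) ⟨e, D, s⟩)) +
        (Multiset.replicate (K * phaseLength n k) (filler n k K L s) +
        Multiset.replicate (fillerCount n k τ) ⟨e, fillerDeadline n k K L, s⟩) := by
      rw [hσ, burstInput, calmInput, burst, ← Multiset.cons_add]
      abel
    rw [h4, Multiset.countP_add, Multiset.countP_eq_zero.2, zero_add]
    · exact (Multiset.countP_le_card _ _).trans (by simp)
    · intro q hq
      rw [not_not]
      rw [Multiset.mem_add, Multiset.mem_cons] at hq
      rcases hq with h | rfl | h
      · obtain ⟨j, -, h⟩ := Multiset.mem_sum.1 h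
        obtain ⟨v, rfl⟩ := mem_demandBatch h
        exact le_rfl
      · exact h2
      · rw [Multiset.eq_of_mem_replicate h]
  have h10 : horizon σ = fillerDeadline n k K L + 1 := horizon_burstInput hn hτ
  have h11 : (served σ s a (horizon σ)).countP p ≤
      (served σ s a e).countP p + (min (horizon σ) (D + 1) - e) :=
    countP_served_le σ s a D e (horizon σ) (by omega)
  have h12 : σ.card + n * (τ / 3 + 1) = fillerDeadline n k K L := card_burstInput hτ
  have h13 := phaseStart_succ_eq n k τ
  have h14 : (served σ s a (horizon σ)).card = _ :=
    Multiset.card_eq_countP_add_countP p (served σ s a (horizon σ))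
  have h15 : fillerDeadline n k K L = D + K * phaseLength n k := rfl
  have h16 : (τ + 1) * (n * k) = τ * (n * k) + k * n := by ring
  rw [← hV, mul_comm k V.card]
  change (served σ s a (horizon σ)).card + k * n ≤ _
  omega

end Online

end UniformTSP

/-! ### The offline optimum -/

namespace UniformTSP

variable {n : ℕ} {k K L τ : ℕ} {s : Fin n}

theorem fillerCount_le (hτ : τ < K) : fillerCount n k τ ≤ K * phaseLength n k := by
  have h1 := phaseStart_succ_eq n k τ
  have h2 := phaseStart_mono n k (Nat.succ_le_of_lt hτ)
  have h3 : phaseStart n k K = 1 + K * phaseLength n k := rfl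
  rw [Nat.succ_eq_add_one] at h2
  omega

/-- A round trip that serves three batches fills a phase. -/
theorem fillerCount_add_three (n k τ : ℕ) :
    fillerCount n k (τ + 3) = fillerCount n k τ + 2 * phaseLength n k := by
  have h1 := add_fillerCount n k τ
  have h2 := add_fillerCount n k (τ + 3)
  have h3 : (τ + 3) / 3 = τ / 3 + 1 := by omega
  rw [h3] at h2
  have h4 : n * ((τ + 3 + 1) * (2 * k + 1)) =
      n * ((τ + 1) * (2 * k + 1)) + 2 * phaseLength n k + n := by
    unfold phaseLength; ring
  rw [h4, Nat.mul_add n (τ / 3 + 1), mul_one] at h2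
  omega

/-- Serve `f` fillers, then the demands of the batches `i, …, i + c - 1` in a round trip. -/
theorem Reach.phase {σ : Input n} {t i c f g : ℕ}
    (h : Reach σ s t s (Multiset.replicate g (filler n k K L s) +
      ∑ j ∈ Finset.range i, demandBatch n k K L j))
    (ht : 1 ≤ t) (hi : ∀ j < i + c, phaseStart n k j ≤ t + f)
    (hD : t + f + n * (c * k + 1) ≤ demandDeadline n k K L + 1)
    (hσ : Multiset.replicate (g + f) (filler n k K L s) +
      ∑ j ∈ Finset.range (i + c), demandBatch n k K L j ≤ σ) :
    Reach σ s (t + f + n * (c * k + 1)) s (Multiset.replicate (g + f) (filler n k K L s) +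
      ∑ j ∈ Finset.range (i + c), demandBatch n k K L j) := by
  have hlast : demandDeadline n k K L ≤ fillerDeadline n k K L := Nat.le_add_right _ _
  have hS : Multiset.replicate (g + f) (filler n k K L s) +
      ∑ j ∈ Finset.range (i + c), demandBatch n k K L j =
      (Multiset.replicate g (filler n k K L s) + ∑ j ∈ Finset.range i, demandBatch n k K L j +
        Multiset.replicate f (filler n k K L s)) +
      ∑ v : Fin n, ∑ j ∈ Finset.Ico i (i + c), Multiset.replicate k (demand k K L j v) := by
    rw [Finset.sum_comm, Multiset.replicate_add,
      ← Finset.sum_range_add_sum_Ico _ (Nat.le_add_right i c)]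
    simp only [demandBatch]
    abel
  rw [hS] at hσ ⊢
  have h1 := h.serve (Multiset.replicate f (filler n k K L s)) (fun q hq => by
    rw [Multiset.eq_of_mem_replicate hq, Multiset.card_replicate]
    exact ⟨rfl, ht, by simp only [filler]; omega⟩) ((Multiset.le_add_right _ _).trans hσ)
  rw [Multiset.card_replicate] at h1
  refine h1.roundTrip _ (c * k) (fun v => by simp [Multiset.card_sum]) (fun v q hq => ?_) hσ
  obtain ⟨j, hj, hq⟩ := Multiset.mem_sum.1 hq
  rw [Multiset.eq_of_mem_replicate hq]
  exact ⟨rfl, hi j (Finset.mem_Ico.1 hj).2, hD⟩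

/-- The round trips are aligned backwards from phase m, whence the induction in steps of three. A
full trip occupies exactly one phase, at whose start the last of its three batches is released. -/
theorem reach_phases {σ : Input n} (m : ℕ) (hm : m < K)
    (hσ : Multiset.replicate (fillerCount n k m) (filler n k K L s) +
      ∑ j ∈ Finset.range (m + 1), demandBatch n k K L j ≤ σ) :
    Reach σ s (phaseStart n k (m + 1)) s
      (Multiset.replicate (fillerCount n k m) (filler n k K L s) +
        ∑ j ∈ Finset.range (m + 1), demandBatch n k K L j) := by
  induction m using Nat.strong_induction_on with
  | _ m ih =>
    have hD := phaseStart_add_le (n := n) (k := k) (L := L) hm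
    rcases lt_or_ge m 3 with h3 | h3
    -- With at most three batches, one trip at the end of phase m serves them all; slot 0 is idled
    -- away.
    · have h0 : Reach σ s 1 s (Multiset.replicate 0 (filler n k K L s) +
          ∑ j ∈ Finset.range 0, demandBatch n k K L j) := by
        have : Reach σ s 0 s 0 := ⟨fun _ => .idle, rfl, rfl⟩
        simpa using this.idle
      have h1 : 1 + fillerCount n k m + n * ((m + 1) * k + 1) = phaseStart n k (m + 1) := by
        have h4 : m / 3 = 0 := by omega
        rw [phaseStart_succ_eq, h4]; ring
      have h2 : n * ((m + 1) * k + 1) ≤ phaseLength n k := by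
        unfold phaseLength
        rw [mul_comm n]
        gcongr
        omega
      have h5 := phaseStart_succ n k m
      have := h0.phase (i := 0) (g := 0) (f := fillerCount n k m) (c := m + 1) le_rfl
        (fun j hj => by
          have := phaseStart_mono n k (show j ≤ m by omega)
          omega) (by omega) (by simpa using hσ)
      rw [h1] at this
      simpa using this
    · obtain ⟨m, rfl⟩ := Nat.exists_eq_add_of_le' h3
      have hf := fillerCount_add_three n k m
      rw [hf] at hσ ⊢
      have h0 := ih m (by omega) (by omega) (le_trans (add_le_add
        (Multiset.replicate_le_replicate _ |>.2 (Nat.le_add_right _ _))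
        (Finset.sum_le_sum_of_subset (Finset.range_subset_range.2 (by omega)))) hσ)
      have h5 : phaseStart n k (m + 2) = phaseStart n k (m + 1) + phaseLength n k :=
        phaseStart_succ n k (m + 1)
      have h6 : phaseStart n k (m + 3) = phaseStart n k (m + 2) + phaseLength n k :=
        phaseStart_succ n k (m + 2)
      have h7 : phaseStart n k (m + 3 + 1) = phaseStart n k (m + 3) + phaseLength n k :=
        phaseStart_succ n k (m + 3)
      have h8 : n * (3 * k + 1) = phaseLength n k := mul_comm _ _
      have h9 : phaseStart n k (m + 1) + 2 * phaseLength n k + n * (3 * k + 1) =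
        phaseStart n k (m + 3 + 1) := by omega
      have := h0.phase (f := 2 * phaseLength n k) (c := 3) (one_le_phaseStart _ _ _)
        (fun j hj => by
          have := phaseStart_mono n k (show j ≤ m + 3 by omega)
          omega) (by omega) (by rw [show m + 1 + 3 = m + 3 + 1 by ring]; exact hσ)
      rw [h9, show m + 1 + 3 = m + 3 + 1 by ring] at this
      exact this

/-- Offline, all requests can be served. -/
theorem card_le_opt_burstInput (hn : 0 < n) (hτ : τ < K) :
    (burstInput n k K L s τ).card ≤ opt (burstInput n k K L s τ) s := by
  set σ := burstInput n k K L s τ with hσ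
  have hD := phaseStart_add_le (n := n) (k := k) (L := L) hτ
  have hf := fillerCount_le (n := n) (k := k) hτ
  have hlast : fillerDeadline n k K L = demandDeadline n k K L + K * phaseLength n k := rfl
  have hpos := one_le_phaseStart n k (τ + 1)
  obtain ⟨r, hr⟩ := Nat.exists_eq_add_of_le hf
  set e := phaseStart n k (τ + 1) with he
  set D := demandDeadline n k K L with hDdef
  set S₀ := Multiset.replicate (fillerCount n k τ) (filler n k K L s) +
      ∑ j ∈ Finset.range (τ + 1), demandBatch n k K L j with hS₀
  have hdecomp : σ = S₀ + {⟨e, e + L, s⟩} + Multiset.replicate (D - e) ⟨e, D, s⟩ +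
      (Multiset.replicate (fillerCount n k τ) ⟨e, fillerDeadline n k K L, s⟩ +
        Multiset.replicate r (filler n k K L s)) := by
    rw [hσ, burstInput, calmInput, burst, hr, Multiset.replicate_add, ← Multiset.singleton_add, hS₀]
    abel
  have hle₃ := hdecomp.ge
  have hle₂ := (Multiset.le_add_right _ _).trans hle₃
  have hle₁ := (Multiset.le_add_right _ _).trans hle₂
  have h0 : Reach σ s e s S₀ := reach_phases τ hτ ((Multiset.le_add_right _ _).trans hle₁)
  have h1 := h0.serve {⟨e, e + L, s⟩} (fun q hq => by
    rw [Multiset.mem_singleton.1 hq, Multiset.card_singleton]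
    exact ⟨rfl, le_rfl, by simp only; omega⟩) hle₁
  rw [Multiset.card_singleton] at h1
  have h2 := h1.serve (Multiset.replicate (D - e) ⟨e, D, s⟩) (fun q hq => by
    rw [Multiset.eq_of_mem_replicate hq, Multiset.card_replicate]
    exact ⟨rfl, Nat.le_succ _, by simp only; omega⟩) hle₂
  rw [Multiset.card_replicate] at h2
  have h3 := h2.serve (Multiset.replicate (fillerCount n k τ) ⟨e, fillerDeadline n k K L, s⟩ +
      Multiset.replicate r (filler n k K L s)) (fun q hq => by
    rw [Multiset.card_add, Multiset.card_replicate, Multiset.card_replicate]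
    rcases Multiset.mem_add.1 hq with hq | hq <;> rw [Multiset.eq_of_mem_replicate hq]
    · exact ⟨rfl, by simp only; omega, by simp only; omega⟩
    · exact ⟨rfl, by simp only [filler]; omega, by simp only [filler]; omega⟩) hle₃
  rw [← hdecomp, Multiset.card_add, Multiset.card_replicate, Multiset.card_replicate] at h3
  refine h3.card_le_opt ?_
  have h4 : horizon σ = fillerDeadline n k K L + 1 := horizon_burstInput hn hτ
  omega

/-! ### Averaging the loss over the time of the burst -/

/-- The lost requests of `A`, summed over the possible times of the burst. -/
noncomputable def totalLoss (k K L : ℕ) (s : Fin n) (A : OnlineAlgorithm n) : ℝ :=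
  ∑ τ ∈ Finset.range K, (((burstInput n k K L s τ).card : ℝ) - alg A (burstInput n k K L s τ) s)

theorem loss_ge_unvisited (A : OnlineAlgorithm n) (hn : 0 < n) (hτ : τ < K) :
    (k : ℝ) * (n - visitedCount k K L s A τ) ≤
      ((burstInput n k K L s τ).card : ℝ) - alg A (burstInput n k K L s τ) s := by
  have h : ((alg A (burstInput n k K L s τ) s + k * n : ℕ) : ℝ) ≤
    ((burstInput n k K L s τ).card + k * visitedCount k K L s A τ : ℕ) :=
    Nat.cast_le.2 (alg_add_le A hn hτ)
  push_cast at h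
  linarith

theorem loss_ge_visited (A : OnlineAlgorithm n) (hn : 0 < n) (hτ : τ < K) :
    ((τ + 1 : ℕ) : ℝ) * (n - 1) -
        ∑ j ∈ Finset.range (τ + 1), ((n : ℝ) - visitedCount k K L s A j) -
        n * ((τ / 3 : ℕ) + 1) ≤
      ((burstInput n k K L s τ).card : ℝ) - alg A (burstInput n k K L s τ) s := by
  have h : ((alg A (burstInput n k K L s τ) s +
      ∑ j ∈ Finset.range (τ + 1), visitedCount k K L s A j : ℕ) : ℝ) ≤
    (((burstInput n k K L s τ).card + n * (τ / 3 + 1) + (τ + 1) : ℕ) : ℝ) := by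
    rw [card_burstInput hτ]
    exact Nat.cast_le.2 (alg_add_sum_visitedCount_le A hn hτ)
  rw [Finset.sum_sub_distrib, Finset.sum_const, Finset.card_range, nsmul_eq_mul]
  push_cast at h ⊢
  linarith

theorem unvisited_nonneg (A : OnlineAlgorithm n) (j : ℕ) :
    (0 : ℝ) ≤ (n : ℝ) - visitedCount k K L s A j :=
  sub_nonneg.2 (Nat.cast_le.2 (visitedCount_le A j))

/-- The loss with three phases and one request per node and phase. -/
theorem totalLoss_three (A : OnlineAlgorithm n) (hn : 2 ≤ n) :
    (n : ℝ) / 4 ≤ totalLoss 1 3 L s A := by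
  have hn' : (2 : ℝ) ≤ n := by exact_mod_cast hn
  have h0 := loss_ge_unvisited (k := 1) (K := 3) (L := L) (s := s) A (by omega)
    (show 0 < 3 by omega)
  have h1 := loss_ge_unvisited (k := 1) (K := 3) (L := L) (s := s) A (by omega)
    (show 1 < 3 by omega)
  have h2 := loss_ge_unvisited (k := 1) (K := 3) (L := L) (s := s) A (by omega)
    (show 2 < 3 by omega)
  have h3 := loss_ge_visited (k := 1) (K := 3) (L := L) (s := s) A (by omega)
    (show 2 < 3 by omega)
  have p0 := unvisited_nonneg (k := 1) (K := 3) (L := L) (s := s) A 0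
  have p1 := unvisited_nonneg (k := 1) (K := 3) (L := L) (s := s) A 1
  unfold totalLoss
  simp only [Finset.sum_range_succ, Finset.sum_range_zero] at h3 ⊢
  norm_num at h0 h1 h2 h3 ⊢
  -- With yⱼ the unvisited counts and l the loss at τ = 2, one has l ≥ y₂ and l ≥ 2n - 3 - (y₀ + y₁
  -- + y₂). Hence the total is at least n - 3/2, which is n/4 or more for n ≥ 2.
  linarith

/-- The loss with as many phases as requests per node and phase. -/
theorem totalLoss_self (A : OnlineAlgorithm n) (hn : 2 ≤ n) (K : ℕ) :
    (K : ℝ) * (n * (K - 7) / 24) ≤ totalLoss K K L s A := by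
  have hn' : (2 : ℝ) ≤ n := by exact_mod_cast hn
  set y : ℕ → ℝ := fun j => (n : ℝ) - visitedCount K K L s A j with hy
  set S := ∑ j ∈ Finset.range K, y j with hS
  have h1 : (K : ℝ) * S ≤ totalLoss K K L s A := by
    rw [hS, Finset.mul_sum]
    exact Finset.sum_le_sum fun τ hτ =>
      loss_ge_unvisited A (by omega) (Finset.mem_range.1 hτ)
  have h2 : ∑ τ ∈ Finset.range K, ((n : ℝ) * ((τ : ℝ) - 3) / 6 - S) ≤ totalLoss K K L s A := by
    refine Finset.sum_le_sum fun τ hτ => ?_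
    refine le_trans ?_ (loss_ge_visited A (by omega) (Finset.mem_range.1 hτ))
    have h3 : ∑ j ∈ Finset.range (τ + 1), y j ≤ S :=
      Finset.sum_le_sum_of_subset_of_nonneg
        (Finset.range_subset_range.2 (Finset.mem_range.1 hτ))
        fun j _ _ => unvisited_nonneg A j
    have h4 : ((τ / 3 : ℕ) : ℝ) ≤ (τ : ℝ) / 3 := Nat.cast_div_le
    have h5 : (n : ℝ) * ((τ / 3 : ℕ) + 1) ≤ n * ((τ : ℝ) / 3 + 1) := by gcongr
    -- The bound n - 1 ≥ n/2 leaves n/2 - n/3 = n/6 per phase.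
    have h6 : ((τ : ℝ) + 1) * (n / 2) ≤ (τ + 1) * (n - 1) := by
      gcongr; linarith
    push_cast
    linarith
  -- The number of summands varies in this induction while S stays fixed.
  have h3 : ∀ K : ℕ, ∑ τ ∈ Finset.range K, ((n : ℝ) * ((τ : ℝ) - 3) / 6 - S) =
      K * (n * (K - 7) / 12) - K * S := fun K => by
    induction K with
    | zero => simp
    | succ K ih => rw [Finset.sum_range_succ, ih]; push_cast; ring
  rw [h3] at h2
  -- Adding `h1` and `h2` cancels K * S, at the price of a factor 2.
  linarith

/-- The averaging argument, for deterministic and randomized algorithms alike. -/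
theorem one_add_le_of_totalLoss (hn : 0 < n) (hK : 0 < K) {ρ Λ : ℝ}
    (hΛ : ∀ A : OnlineAlgorithm n, (K : ℝ) * Λ ≤ totalLoss k K L s A) (hΛ' : 0 ≤ Λ)
    (h : (∃ A : OnlineAlgorithm n, IsCompetitive A s L ρ) ∨
      ∃ P : Measure (OnlineAlgorithm n), IsProbabilityMeasure P ∧ IsRandCompetitive P s L ρ) :
    1 + Λ / fillerDeadline n k K L ≤ ρ := by
  set N : ℝ := ∑ τ ∈ Finset.range K, ((burstInput n k K L s τ).card : ℝ) with hN
  have hopt : ∀ τ ∈ Finset.range K,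
      ((burstInput n k K L s τ).card : ℝ) ≤ opt (burstInput n k K L s τ) s := fun τ hτ =>
    Nat.cast_le.2 (card_le_opt_burstInput hn (Finset.mem_range.1 hτ))
  have hlax : ∀ τ ∈ Finset.range K, HasMinLaxity (burstInput n k K L s τ) L := fun τ hτ =>
    hasMinLaxity_burstInput (Finset.mem_range.1 hτ)
  have hA : ∀ A : OnlineAlgorithm n,
      ∑ τ ∈ Finset.range K, (alg A (burstInput n k K L s τ) s : ℝ) ≤ N - K * Λ := fun A => by
    have := hΛ A
    rw [totalLoss, Finset.sum_sub_distrib] at this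
    linarith
  obtain ⟨x, hx0, hx, hNx⟩ : ∃ x : ℝ, 0 ≤ x ∧ x ≤ N - K * Λ ∧ N ≤ ρ * x := by
    rcases h with ⟨A, hA'⟩ | ⟨P, hP, hP'⟩
    · refine ⟨_, Finset.sum_nonneg fun τ _ => Nat.cast_nonneg _, hA A, ?_⟩
      rw [Finset.mul_sum]
      exact Finset.sum_le_sum fun τ hτ => (hopt τ hτ).trans (hA' _ (hlax τ hτ))
    · refine ⟨∑ τ ∈ Finset.range K, ∫ A, (alg A (burstInput n k K L s τ) s : ℝ) ∂P,
        Finset.sum_nonneg fun τ _ => integral_nonneg fun A => Nat.cast_nonneg _, ?_, ?_⟩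
      · rw [← integral_finsetSum _ fun τ _ => integrable_alg P _ s]
        calc _ ≤ ∫ _, (N - K * Λ) ∂P :=
              integral_mono (integrable_finsetSum _ fun τ _ => integrable_alg P _ s)
                (integrable_const _) hA
          _ = _ := by simp
      · rw [Finset.mul_sum]
        exact Finset.sum_le_sum fun τ hτ => (hopt τ hτ).trans (hP' _ (hlax τ hτ))
  set D : ℝ := ((fillerDeadline n k K L : ℕ) : ℝ) with hD
  have hDpos : 0 < D :=
    Nat.cast_pos.2 ((Nat.zero_le _).trans_lt (demandDeadline_lt hn hK))
  have hK' : (0 : ℝ) < K := Nat.cast_pos.2 hK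
  have hND : N ≤ K * D := by
    calc N ≤ ∑ _τ ∈ Finset.range K, D := Finset.sum_le_sum fun τ hτ => by
          have := card_burstInput (n := n) (k := k) (L := L) (s := s) (Finset.mem_range.1 hτ)
          exact Nat.cast_le.2 (by omega)
      _ = K * D := by simp
  have hNpos : 0 < N := by
    refine Finset.sum_pos (fun τ hτ => ?_) (Finset.nonempty_range_iff.2 hK.ne')
    obtain ⟨q, hq, -⟩ := (hlax τ hτ).2.2
    exact Nat.cast_pos.2 (Multiset.card_pos_iff_exists_mem.2 ⟨q, hq⟩)
  by_contra hρ
  rw [not_le] at hρ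
  have hz : Λ / D * N ≤ K * Λ := by
    rw [div_mul_eq_mul_div, div_le_iff₀ hDpos]
    nlinarith
  have hz0 : 0 ≤ Λ / D := div_nonneg hΛ' hDpos.le
  have hxpos : 0 < x := by
    rcases hx0.lt_or_eq with h | h
    · exact h
    · rw [← h, mul_zero] at hNx; linarith
  have h1 : ρ * x < (1 + Λ / D) * x := mul_lt_mul_of_pos_right hρ hxpos
  have h2 : (1 + Λ / D) * x ≤ (1 + Λ / D) * (N - Λ / D * N) :=
    mul_le_mul_of_nonneg_left (by linarith) (by linarith)
  -- This is (1 + z)(1 - z) ≤ 1 for z = Λ / D.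
  have h3 : (1 + Λ / D) * (N - Λ / D * N) ≤ N := by
    nlinarith [mul_nonneg (mul_nonneg hz0 hz0) hNpos.le]
  linarith

end UniformTSP

/-! ### Choice of the parameters -/

theorem mainTheorem7 :
    ∃ c : ℝ, 0 < c ∧ ∀ n : ℕ, 2 ≤ n → ∀ L : ℕ, 1 ≤ L → ∀ (s : Fin n) (ρ : ℝ),
      ((∃ A : UniformTSP.OnlineAlgorithm n, UniformTSP.IsCompetitive A s L ρ) ∨
        (∃ P : MeasureTheory.Measure (UniformTSP.OnlineAlgorithm n),
          MeasureTheory.IsProbabilityMeasure P ∧ UniformTSP.IsRandCompetitive P s L ρ)) →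
      (9 * n ≤ L → 1 + c * √((n : ℝ) / (L : ℝ)) ≤ ρ) ∧
      (L < 9 * n → (1.002 : ℝ) ≤ ρ) := by
  -- 3120 = 24 * 130: the 24 is from `totalLoss_self`, the 130 from `hD`.
  refine ⟨1 / 3120, by norm_num, fun n hn L hL s ρ h => ⟨fun hnL => ?_, fun hLn => ?_⟩⟩
  · have hn' : (0 : ℝ) < n := Nat.cast_pos.2 (by omega)
    have hL' : (0 : ℝ) < L := Nat.cast_pos.2 (by omega)
    set q : ℝ := √((L : ℝ) / n) with hq
    have hq2 : q ^ 2 * n = L := by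
      rw [hq, Real.sq_sqrt (by positivity)]; field_simp
    have hq3 : 3 ≤ q := by
      refine Real.le_sqrt_of_sq_le ?_
      rw [le_div_iff₀ hn']
      have : ((9 * n : ℕ) : ℝ) ≤ L := Nat.cast_le.2 hnL
      push_cast at this
      linarith
    -- The offset 8 makes K - 7 at least q, and q ≥ 3 keeps K at most 4q.
    set K := ⌊q⌋₊ + 8 with hK
    have hK1 : (K : ℝ) ≤ 4 * q := by
      have := Nat.floor_le (show 0 ≤ q by linarith)
      rw [hK]; push_cast; linarith
    have hK2 : q ≤ K - 7 := by
      have := Nat.lt_floor_add_one q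
      rw [hK]; push_cast; linarith
    have hD : (UniformTSP.fillerDeadline n K K L : ℝ) ≤ 130 * L := by
      have h1 : (UniformTSP.fillerDeadline n K K L : ℝ) =
          1 + L + (6 * (K : ℝ) ^ 2 + 2 * K) * n := by
        simp only [UniformTSP.fillerDeadline, UniformTSP.demandDeadline, UniformTSP.phaseStart,
          UniformTSP.phaseLength]
        push_cast
        ring
      have h2 : (K : ℝ) ^ 2 ≤ 16 * q ^ 2 := by nlinarith
      have h3 : 6 * (K : ℝ) ^ 2 + 2 * K ≤ 128 * q ^ 2 := by nlinarith
      have h4 := mul_le_mul_of_nonneg_right h3 hn'.le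
      have h5 : (1 : ℝ) ≤ L := Nat.one_le_cast.2 hL
      rw [h1]
      linarith
    have key := UniformTSP.one_add_le_of_totalLoss (k := K) (K := K) (by omega)
      (by omega) (Λ := n * (K - 7) / 24) (fun A => UniformTSP.totalLoss_self A hn K)
      (by have : (0 : ℝ) ≤ (K : ℝ) - 7 := by linarith
          positivity) h
    refine le_trans ?_ key
    gcongr
    have hDpos : (0 : ℝ) < UniformTSP.fillerDeadline n K K L :=
      Nat.cast_pos.2 (by simp only [UniformTSP.fillerDeadline, UniformTSP.demandDeadline,
        UniformTSP.phaseStart]; omega)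
    have hinv : √((n : ℝ) / L) = n * q / L := by
      have h1 : √((n : ℝ) / L) = q⁻¹ := by rw [hq, ← Real.sqrt_inv, inv_div]
      have hq0 : q ≠ 0 := by linarith
      rw [h1, ← hq2]
      field_simp
    calc 1 / 3120 * √((n : ℝ) / L) = n * q / 24 / (130 * L) := by rw [hinv]; ring
      _ ≤ n * (K - 7) / 24 / (130 * L) := by gcongr
      _ ≤ n * (K - 7) / 24 / UniformTSP.fillerDeadline n K K L := by
        have : (0 : ℝ) ≤ (K : ℝ) - 7 := by linarith
        gcongr
  · have hn' : (0 : ℝ) < n := Nat.cast_pos.2 (by omega)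
    -- The total loss n/4 is shared among three burst times; 1/(12 * 33) exceeds 0.002.
    have key := UniformTSP.one_add_le_of_totalLoss (k := 1) (K := 3) (by omega)
      (by omega) (Λ := n / 12) (fun A => le_trans (by push_cast; linarith)
        (UniformTSP.totalLoss_three A hn)) (by positivity) h
    refine le_trans ?_ key
    have hD : (UniformTSP.fillerDeadline n 1 3 L : ℝ) ≤ 33 * n := by
      have h1 : UniformTSP.fillerDeadline n 1 3 L ≤ 33 * n := by
        simp only [UniformTSP.fillerDeadline, UniformTSP.demandDeadline, UniformTSP.phaseStart,
          UniformTSP.phaseLength]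
        omega
      exact_mod_cast h1
    have hDpos : (0 : ℝ) < UniformTSP.fillerDeadline n 1 3 L :=
      Nat.cast_pos.2 (by simp only [UniformTSP.fillerDeadline, UniformTSP.demandDeadline,
        UniformTSP.phaseStart]; omega)
    have h2 : (0.002 : ℝ) ≤ n / 12 / UniformTSP.fillerDeadline n 1 3 L := by
      rw [le_div_iff₀ hDpos]
      linarith
    linarith
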